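/- A bipartite one-shot radio network of size $n$ is an undirected graph on $n$ nodes whose node set is partitioned into senders and receivers, with every edge joining a sender and a receiver and with every receiver having at least one sender neighbour; exactly the senders hold a message to broadcast, from the beginning of round one. The contention of a node is the number of its neighbours that are senders. A transmission schedule of length $T$ is a sequence $\sigma_1,\dots,\sigma_T$ of sets of senders, $\sigma_r$ being the set of senders that transmit in round $r$; a receiver $v$ receives a message in round $r$ if and only if exactly one neighbour of $v$ belongs to $\sigma_r$. There is an absolute constant $c>0$ such that for all integers $1\le\Delta\le n$ there exists a bipartite one-shot radio network of size $n$ and maximum contention at most $\Delta$ with the following property: every transmission schedule during which each receiver receives at least one message has length at least $c\,\log\Delta\,\log n$. -/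

import Mathlib

/-- A network of the classical radio broadcast model (one undirected graph, all links reliable)
in the bipartite one-shot setting on the node set `V`.  The nodes are partitioned into senders and
receivers (the complement of `senders`), all edges run between the two parts, and every receiver
has a sender neighbour.  Exactly the senders receive a broadcast input, all of them at the
beginning of round one. -/
structure OneShotNetwork (V : Type) [Fintype V] [DecidableEq V] where
  graph : SimpleGraph V
  senders : Finset V
  bipartite : graph.IsBipartiteWith (senders : Set V) ((sendersᶜ : Finset V) : Set V)
  exists_sender : ∀ v ∈ sendersᶜ, ∃ u ∈ senders, graph.Adj v u

namespace OneShotNetwork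

variable {V : Type} [Fintype V] [DecidableEq V] (N : OneShotNetwork V)

/-- The set of receivers. -/
def receivers : Finset V := N.sendersᶜ

open scoped Classical in
/-- The nodes among `A` that are adjacent to `v`. -/
noncomputable def neighborsIn (A : Finset V) (v : V) : Finset V :=
  A.filter (fun u => N.graph.Adj v u)

/-- The contention at `v` in round one: the number of neighbours of `v` that are active, that is,
that have received a broadcast input. -/
noncomputable def contention (v : V) : ℕ := (N.neighborsIn N.senders v).card

/-- The maximum contention over all nodes. -/
noncomputable def maxContention : ℕ := Finset.univ.sup N.contention

/-- If `B` is the set of nodes that transmit in a round, then `v` receives the message of another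
node in this round iff `v` does not transmit and exactly one neighbour of `v` transmits. -/
def Receives (B : Finset V) (v : V) : Prop :=
  v ∉ B ∧ (N.neighborsIn B v).card = 1

/-- A transmission schedule of length `T`: for each of the `T` rounds, the set of senders that
transmit in this round. -/
def Schedule (T : ℕ) : Type := Fin T → {B : Finset V // B ⊆ N.senders}

/-- During the `T` rounds of the schedule, each receiver receives at least one message. -/
def Schedule.Progressive {N : OneShotNetwork V} {T : ℕ} (σ : N.Schedule T) : Prop :=
  ∀ v ∈ N.receivers, ∃ r : Fin T, N.Receives (σ r).1 v

end OneShotNetwork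

/-! Take `16 ^ b` senders with `b` of order `log n`, and fix the sets `A r` of a schedule. Draw two
independent `K`-tuples of senders. If both hit the same sets `A r` and their ranges are disjoint,
each `A r` meets the union of the ranges in no point or in at least two, so a receiver with this
neighbourhood hears nothing.

Equal hitting patterns have probability at least `exp (-h)`, where `h` sums the entropies of the
single rounds (`exp_neg_sum_binEntropy_le_card_collisions`). A set of density `a` yields notable
entropy only for `K` near `1 / a`, so over all scales `K = 4 ^ i` each round contributes at most 12
(`sum_binEntropy_one_sub_pow_le`). With `L` scales, `L` of order `log Δ`, and at most `L * b / 24`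
rounds, some scale has `h ≤ b / 2`.

Hence any family of schedules has one neighbourhood defeating an inverse-polynomial fraction of it,
and greedy covering defeats all schedules with polynomially many receivers. -/

open Finset Real

/-! ### Entropy of hitting patterns -/

/-- The number of pairs of points with the same binary pattern is bounded below through the sum
of the entropies of the coordinates of the pattern. -/
theorem exp_neg_sum_binEntropy_le_card_collisions {X ι : Type*} [Fintype X] [Nonempty X]
    [Fintype ι] [DecidableEq ι] (φ : X → ι → Bool) (q : ι → ℝ)
    (hq : ∀ r, ((univ.filter fun x => φ x r = false).card : ℝ) = q r * Fintype.card X) :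
    (Fintype.card X : ℝ) ^ 2 * exp (-∑ r, binEntropy (q r)) ≤
      ((univ.filter fun z : X × X => φ z.1 = φ z.2).card : ℝ) := by
  classical
  have hX : (0 : ℝ) < Fintype.card X := by exact_mod_cast Fintype.card_pos
  set w : ι → Bool → ℝ := fun r b => bif b then 1 - q r else q r with hw
  have hcount : ∀ r b, ((univ.filter fun x => φ x r = b).card : ℝ) = w r b * Fintype.card X := by
    intro r b
    cases b
    · exact hq r
    · have h := card_filter_add_card_filter_not (s := (univ : Finset X)) (fun x => φ x r = false)
      simp only [Bool.not_eq_false, card_univ] at h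
      have h' : ((univ.filter fun x => φ x r = false).card : ℝ) +
        ((univ.filter fun x => φ x r = true).card : ℝ) = Fintype.card X := by exact_mod_cast h
      rw [hq r] at h'
      simp only [hw, cond_true]
      linarith
  have hw0 : ∀ r b, 0 ≤ w r b := fun r b =>
    nonneg_of_mul_nonneg_left (by rw [← hcount]; positivity) hX
  have hwpos : ∀ x r, 0 < w r (φ x r) := by
    intro x r
    refine pos_of_mul_pos_left ?_ hX.le
    rw [← hcount]
    exact_mod_cast card_pos.2 ⟨x, by simp⟩
  -- `Q` is the product measure with the marginals of `φ`. As its mass is 1, Cauchy–Schwarz against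
  -- `√Q` bounds the collision count `∑ v, N v ^ 2` from below.
  set Q : (ι → Bool) → ℝ := fun v => ∏ r, w r (v r) with hQ
  have hQ0 : ∀ v, 0 ≤ Q v := fun v => prod_nonneg fun r _ => hw0 r _
  have hQsum : ∑ v, Q v = 1 := by
    have h := Finset.prod_univ_sum (fun _ : ι => (univ : Finset Bool)) w
    rw [Fintype.piFinset_univ] at h
    rw [hQ, ← h]
    exact prod_eq_one fun r _ => by simp [hw]
  set N : (ι → Bool) → ℝ := fun v => ((univ.filter fun x => φ x = v).card : ℝ) with hN
  have hpairs : ((univ.filter fun z : X × X => φ z.1 = φ z.2).card : ℝ) = ∑ v, N v ^ 2 := by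
    rw [card_eq_sum_card_fiberwise (f := fun z : X × X => φ z.1) (t := univ)
      (fun _ _ => mem_coe.2 (mem_univ _))]
    push_cast
    refine sum_congr rfl fun v _ => ?_
    rw [sq, ← Nat.cast_mul, ← card_product]
    congr 2
    ext ⟨x, y⟩
    simp only [mem_filter, mem_univ, true_and, mem_product]
    constructor
    · rintro ⟨h1, h2⟩
      exact ⟨h2, h1 ▸ h2⟩
    · rintro ⟨h1, h2⟩
      exact ⟨h1.trans h2.symm, h1⟩
  have hsum : ∑ x, √(Q (φ x)) = ∑ v, N v * √(Q v) := by
    rw [← sum_fiberwise univ φ]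
    refine sum_congr rfl fun v _ => ?_
    rw [sum_congr rfl (g := fun _ => √(Q v)), sum_const, nsmul_eq_mul]
    intro x hx
    rw [(mem_filter.1 hx).2]
  have hCS : (∑ x, √(Q (φ x))) ^ 2 ≤ ∑ v, N v ^ 2 := by
    rw [hsum]
    refine (sum_mul_sq_le_sq_mul_sq _ _ _).trans_eq ?_
    rw [sum_congr rfl fun v _ => sq_sqrt (hQ0 v), hQsum, mul_one]
  have hlog : ∑ x, log (Q (φ x)) = -(Fintype.card X * ∑ r, binEntropy (q r)) := by
    have h1 : ∀ x, log (Q (φ x)) = ∑ r, log (w r (φ x r)) := fun x =>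
      log_prod fun r _ => (hwpos x r).ne'
    rw [sum_congr rfl fun x _ => h1 x, sum_comm, mul_sum, ← sum_neg_distrib]
    refine sum_congr rfl fun r _ => ?_
    rw [← sum_fiberwise univ (fun x => φ x r)]
    have h2 : ∀ b, ∑ x ∈ univ.filter (fun x => φ x r = b), log (w r (φ x r)) =
        w r b * Fintype.card X * log (w r b) := by
      intro b
      rw [sum_congr rfl (g := fun _ => log (w r b)), sum_const, nsmul_eq_mul, hcount]
      intro x hx
      rw [(mem_filter.1 hx).2]
    rw [sum_congr rfl fun b _ => h2 b, binEntropy_eq_negMulLog_add_negMulLog_one_sub]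
    simp [hw, negMulLog]
    ring
  -- Jensen for `exp` at the points `log (Q (φ x)) / 2`, whose mean is minus half the entropy sum.
  have hJ : exp (-(1 / 2) * ∑ r, binEntropy (q r)) ≤
      (Fintype.card X : ℝ)⁻¹ * ∑ x, √(Q (φ x)) := by
    have h := convexOn_exp.map_sum_le (t := (univ : Finset X))
      (w := fun _ => (Fintype.card X : ℝ)⁻¹) (p := fun x => log (Q (φ x)) / 2)
      (fun _ _ => by positivity) (by simp [hX.ne']) (fun _ _ => Set.mem_univ _)
    simp only [smul_eq_mul, ← mul_sum, ← sum_div, hlog] at h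
    have h4 : (Fintype.card X : ℝ)⁻¹ * (-(Fintype.card X * ∑ r, binEntropy (q r)) / 2) =
        -(1 / 2) * ∑ r, binEntropy (q r) := by
      field_simp
    rw [h4] at h
    refine h.trans_eq (congrArg _ (sum_congr rfl fun x _ => ?_))
    rw [exp_half, exp_log (prod_pos fun r _ => hwpos x r)]
  have h3 : Fintype.card X * exp (-(1 / 2) * ∑ r, binEntropy (q r)) ≤ ∑ x, √(Q (φ x)) := by
    rwa [inv_mul_eq_div, le_div_iff₀' hX] at hJ
  rw [hpairs]
  refine le_trans (le_of_eq ?_) ((pow_le_pow_left₀ (by positivity) h3 2).trans hCS)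
  rw [mul_pow, ← exp_nat_mul]
  congr 2
  push_cast
  ring

/-- The term `-2 * q` is kept to absorb `negMulLog (1 - q) ≤ q` in the bound for `binEntropy`. -/
theorem negMulLog_le_two_mul_sqrt_sub {q : ℝ} (h0 : 0 ≤ q) : negMulLog q ≤ 2 * (√q - q) := by
  rcases h0.eq_or_lt with rfl | h
  · simp
  have hs : 0 < √q := sqrt_pos.2 h
  have h1 := log_le_sub_one_of_pos (inv_pos.2 hs)
  rw [log_inv, log_sqrt h0] at h1
  have h2 := mul_le_mul_of_nonneg_left h1 h0
  have h3 : q * (√q)⁻¹ = √q := by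
    rw [← div_eq_mul_inv, div_sqrt]
  unfold negMulLog
  nlinarith

theorem binEntropy_le_two_mul_sqrt {q : ℝ} (h0 : 0 ≤ q) (h1 : q ≤ 1) :
    binEntropy q ≤ 2 * √q := by
  have hq := negMulLog_le_two_mul_sqrt_sub h0
  have h2 : negMulLog (1 - q) ≤ q := by
    rcases h1.eq_or_lt with rfl | h
    · simp
    have h3 : 0 < 1 - q := by linarith
    have h4 := one_sub_inv_le_log_of_pos h3
    have h5 := mul_le_mul_of_nonneg_left h4 h3.le
    rw [mul_sub, mul_inv_cancel₀ h3.ne'] at h5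
    unfold negMulLog
    linarith
  rw [binEntropy_eq_negMulLog_add_negMulLog_one_sub]
  linarith

/-- The entropy of the event that `K` independent points all avoid a set of density `a`. -/
theorem binEntropy_one_sub_pow_le {a : ℝ} (h0 : 0 ≤ a) (h1 : a ≤ 1) (i : ℕ) :
    binEntropy ((1 - a) ^ 4 ^ i) ≤
      12 * (2 ^ (i + 1) * √a / (1 + 2 ^ (i + 1) * √a)) - 12 * (2 ^ i * √a / (1 + 2 ^ i * √a)) := by
  set q := (1 - a) ^ 4 ^ i with hq
  -- The mean number of hits is `y ^ 2`. The entropy is at most `2 * min y (1 / y)` up to a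
  -- constant, which is dominated by the increment of `12 * y / (1 + y)` from `y` to `2 * y`; such
  -- increments telescope over `i`.
  set y := 2 ^ i * √a with hy
  have hy0 : 0 ≤ y := by positivity
  have hq0 : 0 ≤ q := pow_nonneg (by linarith) _
  have hq1 : q ≤ 1 := pow_le_one₀ (by linarith) (by linarith)
  have hy2 : y ^ 2 = 4 ^ i * a := by
    rw [hy, mul_pow, sq_sqrt h0, ← pow_mul, mul_comm i 2, pow_mul]; norm_num
  have hA : 1 - q ≤ y ^ 2 := by
    have h := one_add_mul_le_pow (a := -a) (by linarith) (4 ^ i)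
    rw [hy2, hq, sub_eq_add_neg 1 a]
    push_cast at h
    linarith
  have hB : q * y ^ 2 ≤ 1 := by
    have h2 : q ≤ exp (-(y ^ 2)) := by
      have h3 : 1 - a ≤ exp (-a) := by
        have := add_one_le_exp (-a)
        linarith
      refine (pow_le_pow_left₀ (by linarith) h3 (4 ^ i)).trans_eq ?_
      rw [← exp_nat_mul, hy2]
      push_cast
      ring_nf
    have h4 : y ^ 2 ≤ exp (y ^ 2) := by
      have := add_one_le_exp (y ^ 2)
      linarith
    calc q * y ^ 2 ≤ exp (-(y ^ 2)) * exp (y ^ 2) :=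
          mul_le_mul h2 h4 (by positivity) (exp_pos _).le
      _ = 1 := by rw [← exp_add]; simp
  have hrhs : 12 * (2 ^ (i + 1) * √a / (1 + 2 ^ (i + 1) * √a)) - 12 * (y / (1 + y)) =
      12 * y / ((1 + y) * (1 + 2 * y)) := by
    rw [show 2 ^ (i + 1) * √a = 2 * y by rw [hy]; ring]
    field_simp
    ring
  rw [hrhs, le_div_iff₀ (by positivity)]
  rcases le_total y 1 with h | h
  · have h5 : binEntropy q ≤ 2 * y := by
      rw [← binEntropy_one_sub]
      refine (binEntropy_le_two_mul_sqrt (by linarith) (by linarith)).trans ?_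
      gcongr
      exact sqrt_le_iff.2 ⟨hy0, hA⟩
    have h6 : (1 + y) * (1 + 2 * y) ≤ 6 := by nlinarith
    calc _ ≤ 2 * y * 6 := mul_le_mul h5 h6 (by positivity) (by positivity)
      _ = 12 * y := by ring
  · have hs : √q * y ≤ 1 := by
      refine abs_le_one_iff_mul_self_le_one.2 ?_ |> (le_abs_self _).trans
      rw [← sq, mul_pow, sq_sqrt hq0]
      exact hB
    have h5 := binEntropy_le_two_mul_sqrt hq0 hq1
    have h6 : (1 + y) * (1 + 2 * y) ≤ 6 * y * y := by nlinarith
    calc _ ≤ 2 * √q * (6 * y * y) := mul_le_mul h5 h6 (by positivity) (by positivity)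
      _ = 12 * y * (√q * y) := by ring
      _ ≤ 12 * y * 1 := by gcongr
      _ = 12 * y := by ring

theorem sum_binEntropy_one_sub_pow_le {a : ℝ} (h0 : 0 ≤ a) (h1 : a ≤ 1) (L : ℕ) :
    ∑ i ∈ range L, binEntropy ((1 - a) ^ 4 ^ i) ≤ 12 := by
  refine (sum_le_sum fun i _ => binEntropy_one_sub_pow_le h0 h1 i).trans ?_
  rw [sum_range_sub (fun i => 12 * (2 ^ i * √a / (1 + 2 ^ i * √a)))]
  have h2 : 2 ^ L * √a / (1 + 2 ^ L * √a) ≤ 1 :=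
    div_le_one_of_le₀ (by linarith) (by positivity)
  have h3 : 0 ≤ 2 ^ 0 * √a / (1 + 2 ^ 0 * √a) := by positivity
  linarith

/-! ### Covering and counting tools -/

/-- Greedy covering: if every family of tasks admits a candidate that handles a `p`-fraction of
it, then `R` candidates leave at most a `(1 - p) ^ R`-fraction unhandled. -/
theorem exists_greedy_cover {A B : Type*} [DecidableEq A] (good : A → B → Prop) (P : B → Prop)
    {p : ℝ} (hp : p ≤ 1)
    (H : ∀ s : Finset A, ∃ b, P b ∧ ∃ t ⊆ s, (∀ a ∈ t, good a b) ∧ p * s.card ≤ t.card)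
    (s : Finset A) (R : ℕ) :
    ∃ F : ℕ → B, (∀ j, P (F j)) ∧ ∃ u ⊆ s, (∀ a ∈ s, a ∉ u → ∃ j < R, good a (F j)) ∧
      (u.card : ℝ) ≤ (1 - p) ^ R * s.card := by
  induction R with
  | zero =>
    obtain ⟨b, hb, -⟩ := H ∅
    exact ⟨fun _ => b, fun _ => hb, s, subset_rfl, fun a h h' => (h' h).elim, by simp⟩
  | succ R ih =>
    obtain ⟨F, hF, u, hus, hu, hcard⟩ := ih
    obtain ⟨b, hb, t, htu, ht, htc⟩ := H u
    refine ⟨fun j => if j < R then F j else b, fun j => ?_, u \ t, sdiff_subset.trans hus, ?_, ?_⟩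
    · dsimp only
      split_ifs
      exacts [hF j, hb]
    · intro a ha hau
      by_cases h : a ∈ u
      · have hat : a ∈ t := by
          by_contra h'
          exact hau (mem_sdiff.2 ⟨h, h'⟩)
        exact ⟨R, by omega, by simpa using ht a hat⟩
      · obtain ⟨j, hj, hg⟩ := hu a ha h
        exact ⟨j, by omega, by simpa [hj] using hg⟩
    · rw [cast_card_sdiff htu, pow_succ]
      have h1 : (0 : ℝ) ≤ 1 - p := by linarith
      have := mul_le_mul_of_nonneg_left hcard h1
      linarith

theorem card_pairs_eq_coord {κ α : Type*} [Fintype κ] [DecidableEq κ] [Fintype α] [DecidableEq α]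
    (j l : κ) :
    (univ.filter fun z : (κ → α) × (κ → α) => z.1 j = z.2 l).card * Fintype.card α =
      Fintype.card (κ → α) ^ 2 := by
  have h : ∀ a : α, (univ.filter fun f : κ → α => f j = a).card * Fintype.card α =
      Fintype.card (κ → α) := by
    intro a
    have h1 := Fintype.card_filter_piFinset_const_eq_of_mem (univ : Finset α) j (mem_univ a)
    rw [Fintype.piFinset_univ] at h1
    rw [h1, card_univ, ← pow_succ, Nat.sub_add_cancel (Fintype.card_pos_iff.2 ⟨j⟩), Fintype.card_fun]
  have h2 : (univ.filter fun z : (κ → α) × (κ → α) => z.1 j = z.2 l).card =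
      ∑ g : κ → α, (univ.filter fun f : κ → α => f j = g l).card := by
    rw [card_eq_sum_card_fiberwise (f := fun z : (κ → α) × (κ → α) => z.2) (t := univ)
      (fun _ _ => mem_coe.2 (mem_univ _))]
    refine sum_congr rfl fun g _ => ?_
    refine card_bij (fun z _ => z.1) ?_ ?_ ?_
    · rintro ⟨f, g'⟩ hz
      simp only [mem_filter, mem_univ, true_and] at hz ⊢
      rw [← hz.2, hz.1]
    · rintro ⟨f, g'⟩ hz ⟨f', g''⟩ hz' hf
      simp only [mem_filter, mem_univ, true_and] at hz hz' hf
      rw [hf, hz.2, hz'.2]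
    · intro f hf
      exact ⟨(f, g), by simpa using hf, rfl⟩
  rw [h2, sum_mul, sum_congr rfl fun g _ => h (g l), sum_const, card_univ, smul_eq_mul, sq]

/-- Union bound over the `K ^ 2` pairs of positions. -/
theorem card_pairs_meeting_le {α : Type*} [Fintype α] [DecidableEq α] (K : ℕ) :
    (univ.filter fun z : (Fin K → α) × (Fin K → α) => ∃ j l, z.1 j = z.2 l).card *
      Fintype.card α ≤ K ^ 2 * Fintype.card (Fin K → α) ^ 2 := by
  have h : (univ.filter fun z : (Fin K → α) × (Fin K → α) => ∃ j l, z.1 j = z.2 l) ⊆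
      (univ : Finset (Fin K × Fin K)).biUnion
        fun p => univ.filter fun z : (Fin K → α) × (Fin K → α) => z.1 p.1 = z.2 p.2 := by
    intro z hz
    obtain ⟨j, l, hjl⟩ := (mem_filter.1 hz).2
    exact mem_biUnion.2 ⟨(j, l), mem_univ _, by simpa using hjl⟩
  calc _ ≤ (∑ p : Fin K × Fin K, (univ.filter fun z : (Fin K → α) × (Fin K → α) =>
          z.1 p.1 = z.2 p.2).card) * Fintype.card α :=
        Nat.mul_le_mul_right _ ((card_le_card h).trans card_biUnion_le)
    _ = _ := by
        rw [sum_mul, sum_congr rfl fun p _ => card_pairs_eq_coord p.1 p.2]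
        simp [sq]

/-- Among the pairs of `K`-tuples, many have a union of ranges that none of the given sets meets
in exactly one point. -/
theorem le_card_pairs_not_isolated {α : Type*} [Fintype α] [DecidableEq α] [Nonempty α]
    {T : ℕ} (A : Fin T → Finset α) (K : ℕ) :
    (Fintype.card (Fin K → α) : ℝ) ^ 2 *
        (exp (-∑ r, binEntropy ((1 - ((A r).card : ℝ) / Fintype.card α) ^ K)) -
          (K : ℝ) ^ 2 / Fintype.card α) ≤
      ((univ.filter fun z : (Fin K → α) × (Fin K → α) =>
        ∀ r, (A r ∩ (univ.image z.1 ∪ univ.image z.2)).card ≠ 1).card : ℝ) := by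
  have hα : (0 : ℝ) < Fintype.card α := by exact_mod_cast Fintype.card_pos
  set φ : (Fin K → α) → Fin T → Bool := fun f r => decide (∃ j, f j ∈ A r) with hφ
  have hq : ∀ r, ((univ.filter fun f => φ f r = false).card : ℝ) =
      (1 - ((A r).card : ℝ) / Fintype.card α) ^ K * Fintype.card (Fin K → α) := by
    intro r
    have h1 : (univ.filter fun f => φ f r = false) = Fintype.piFinset fun _ : Fin K => (A r)ᶜ := by
      ext f
      simp [hφ, Fintype.mem_piFinset]
    rw [h1, Fintype.card_piFinset_const, Fintype.card_fun, Fintype.card_fin, card_compl]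
    push_cast [card_le_univ (A r)]
    rw [← mul_pow]
    congr 1
    field_simp
  have hcol := exp_neg_sum_binEntropy_le_card_collisions φ _ hq
  have hmeet : ((univ.filter fun z : (Fin K → α) × (Fin K → α) =>
      ∃ j l, z.1 j = z.2 l).card : ℝ) ≤
      (Fintype.card (Fin K → α) : ℝ) ^ 2 * ((K : ℝ) ^ 2 / Fintype.card α) := by
    rw [← mul_div_assoc, le_div_iff₀ hα, mul_comm ((Fintype.card (Fin K → α) : ℝ) ^ 2)]
    exact_mod_cast card_pairs_meeting_le (α := α) K
  -- If `A r` meets the union only in `x`, equal patterns force both tuples to hit `A r`, hence both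
  -- contain `x`.
  have hsub : (univ.filter fun z : (Fin K → α) × (Fin K → α) => φ z.1 = φ z.2) ⊆
      (univ.filter fun z : (Fin K → α) × (Fin K → α) =>
        ∀ r, (A r ∩ (univ.image z.1 ∪ univ.image z.2)).card ≠ 1) ∪
      (univ.filter fun z : (Fin K → α) × (Fin K → α) => ∃ j l, z.1 j = z.2 l) := by
    rintro ⟨f, g⟩ hz
    simp only [mem_union, mem_filter, mem_univ, true_and] at hz ⊢
    by_contra! hcon
    obtain ⟨⟨r, hr⟩, hne⟩ := hcon
    obtain ⟨x, hx⟩ := card_eq_one.1 hr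
    have hmem : ∀ y, y ∈ A r → ((∃ j, f j = y) ∨ ∃ j, g j = y) → y = x := by
      intro y hy hfg
      rw [← mem_singleton, ← hx]
      simpa [hy] using hfg
    have hxm : x ∈ A r ∩ (univ.image f ∪ univ.image g) := hx ▸ mem_singleton_self x
    have hiff : (∃ j, f j ∈ A r) ↔ ∃ j, g j ∈ A r := by
      have := congrFun hz r
      simpa [hφ] using this
    have hboth : (∃ j, f j ∈ A r) ∧ ∃ j, g j ∈ A r := by
      simp only [mem_inter, mem_union, mem_image, mem_univ, true_and] at hxm
      obtain ⟨hxA, ⟨j, rfl⟩ | ⟨j, rfl⟩⟩ := hxm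
      · exact ⟨⟨j, hxA⟩, hiff.1 ⟨j, hxA⟩⟩
      · exact ⟨hiff.2 ⟨j, hxA⟩, ⟨j, hxA⟩⟩
    obtain ⟨⟨j, hj⟩, l, hl⟩ := hboth
    exact hne j l ((hmem _ hj (Or.inl ⟨j, rfl⟩)).trans (hmem _ hl (Or.inr ⟨l, rfl⟩)).symm)
  have hle : ((univ.filter fun z : (Fin K → α) × (Fin K → α) => φ z.1 = φ z.2).card : ℝ) ≤ _ :=
    Nat.cast_le.2 ((card_le_card hsub).trans (card_union_le _ _))
  push_cast at hle
  linarith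

/-- If `G x y` holds for a `p`-fraction of the `y` for each `x ∈ s`, then some `y` works for a
`p`-fraction of `s`. -/
theorem exists_mul_card_le_card_filter {X Y : Type*} [Fintype Y] [Nonempty Y] (s : Finset X)
    (G : X → Y → Prop) [∀ x y, Decidable (G x y)] {p : ℝ}
    (h : ∀ x ∈ s, p * Fintype.card Y ≤ ((univ.filter fun y => G x y).card : ℝ)) :
    ∃ y, p * s.card ≤ ((s.filter fun x => G x y).card : ℝ) := by
  by_contra! hcon
  have h1 : ∑ y, ((s.filter fun x => G x y).card : ℝ) < ∑ _y : Y, p * s.card :=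
    sum_lt_sum_of_nonempty univ_nonempty fun y _ => hcon y
  have h2 : ∑ y, ((s.filter fun x => G x y).card : ℝ) =
      ∑ x ∈ s, ((univ.filter fun y => G x y).card : ℝ) := by
    exact_mod_cast (sum_card_bipartiteAbove_eq_sum_card_bipartiteBelow G).symm
  have h3 := sum_le_sum h
  rw [h2] at h1
  simp only [sum_const, nsmul_eq_mul, card_univ] at h1 h3
  linarith

/-! ### Neighbourhoods that defeat all short schedules -/

/-- The choice of one candidate set that a large fraction of the given short sequences of sets
fails to isolate. -/
theorem exists_set_not_isolated {b L T₀ Δ : ℕ} (hb : 1 ≤ b) (hL : 1 ≤ L) (hLb : 2 * (L - 1) ≤ b)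
    (hΔ : 2 * 4 ^ (L - 1) ≤ Δ) (hT : 24 * T₀ ≤ L * b)
    (s : Finset (Fin T₀ → Finset (Fin (16 ^ b)))) :
    ∃ S : Finset (Fin (16 ^ b)), (S.Nonempty ∧ S.card ≤ Δ) ∧ ∃ t ⊆ s,
      (∀ A ∈ t, ∀ r, (A r ∩ S).card ≠ 1) ∧ ((1 / 2 ^ (2 * b + 1) : ℝ)) * s.card ≤ t.card := by
  classical
  have : NeZero (16 ^ b) := ⟨by positivity⟩
  have hLpos : (0 : ℝ) < L := by exact_mod_cast hL
  -- `H A i` is the total entropy at scale `4 ^ i`; its sum over the `L` scales is at most `12 * T₀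
  -- ≤ L * b / 2`.
  set H : (Fin T₀ → Finset (Fin (16 ^ b))) → ℕ → ℝ := fun A i =>
    ∑ r, binEntropy ((1 - ((A r).card : ℝ) / Fintype.card (Fin (16 ^ b))) ^ 4 ^ i) with hH
  have hscale : ∀ A, ∃ i ∈ range L, H A i ≤ b / 2 := by
    intro A
    by_contra! hcon
    have h1 : ∑ _i ∈ range L, (b / 2 : ℝ) < ∑ i ∈ range L, H A i :=
      sum_lt_sum_of_nonempty (nonempty_range_iff.2 (by omega)) hcon
    have h2 : ∑ i ∈ range L, H A i ≤ ∑ _r : Fin T₀, (12 : ℝ) := by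
      rw [hH, sum_comm]
      refine sum_le_sum fun r _ => sum_binEntropy_one_sub_pow_le (by positivity) ?_ L
      exact div_le_one_of_le₀ (by exact_mod_cast card_le_univ (A r)) (by positivity)
    simp only [sum_const, card_range, card_univ, Fintype.card_fin, nsmul_eq_mul] at h1 h2
    have h3 : (24 * T₀ : ℝ) ≤ L * b := by exact_mod_cast hT
    linarith
  choose ι hι hHι using hscale
  obtain ⟨i, hi, hcard⟩ : ∃ i ∈ range L,
      (s.card : ℝ) / L ≤ ((s.filter fun A => ι A = i).card : ℝ) := by
    by_contra! hcon
    have h1 := sum_lt_sum_of_nonempty (nonempty_range_iff.2 (by omega)) hcon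
    have h2 := card_eq_sum_card_fiberwise (s := s) (f := ι) (t := range L) (fun A _ => hι A)
    have h3 : (s.card : ℝ) = ∑ i ∈ range L, ((s.filter fun A => ι A = i).card : ℝ) := by
      exact_mod_cast h2
    rw [← h3] at h1
    simp only [sum_const, card_range, nsmul_eq_mul] at h1
    rw [mul_div_cancel₀ _ hLpos.ne'] at h1
    exact lt_irrefl _ h1
  have hiL : i ≤ L - 1 := by
    have := mem_range.1 hi
    omega
  have hfrac : ∀ A ∈ s.filter (fun A => ι A = i), (1 / 2 ^ (b + 1) : ℝ) *
      Fintype.card ((Fin (4 ^ i) → Fin (16 ^ b)) × (Fin (4 ^ i) → Fin (16 ^ b))) ≤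
      ((univ.filter fun z : (Fin (4 ^ i) → Fin (16 ^ b)) × (Fin (4 ^ i) → Fin (16 ^ b)) =>
        ∀ r, (A r ∩ (univ.image z.1 ∪ univ.image z.2)).card ≠ 1).card : ℝ) := by
    intro A hA
    have hAi : H A i ≤ b / 2 := (mem_filter.1 hA).2 ▸ hHι A
    refine le_trans ?_ (le_card_pairs_not_isolated A (4 ^ i))
    rw [Fintype.card_prod, Nat.cast_mul, ← sq, mul_comm]
    refine mul_le_mul_of_nonneg_left ?_ (by positivity)
    have h1 : (1 / 2 ^ b : ℝ) ≤ exp (-H A i) := by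
      have h2 : (1 / 2 ^ b : ℝ) = exp (-(b * log 2)) := by
        rw [exp_neg, exp_nat_mul, exp_log (by norm_num), one_div]
      rw [h2]
      refine exp_le_exp.2 (neg_le_neg (hAi.trans ?_))
      have := log_two_gt_d9
      have hb0 : (0 : ℝ) ≤ b := by positivity
      nlinarith
    -- Meeting ranges cost at most half of the collision probability `1 / 2 ^ b`.
    have h3 : (((4 ^ i : ℕ) : ℝ)) ^ 2 / Fintype.card (Fin (16 ^ b)) ≤ 1 / 2 ^ (b + 1) := by
      have h4 : (4 ^ i : ℕ) ≤ 2 ^ b := by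
        rw [show 4 = 2 ^ 2 by rfl, ← pow_mul]
        exact Nat.pow_le_pow_right (by norm_num) (by omega)
      have h5 : (((4 ^ i : ℕ) : ℝ)) ≤ 2 ^ b := by exact_mod_cast h4
      rw [Fintype.card_fin, div_le_div_iff₀ (by positivity) (by positivity), one_mul]
      have h6 : (2 : ℝ) ≤ 2 ^ b := by
        simpa using pow_le_pow_right₀ (by norm_num : (1 : ℝ) ≤ 2) hb
      calc (((4 ^ i : ℕ) : ℝ)) ^ 2 * 2 ^ (b + 1) ≤ (2 ^ b) ^ 2 * 2 ^ (b + 1) := by gcongr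
        _ = (2 ^ b) ^ 3 * 2 := by ring
        _ ≤ (2 ^ b) ^ 3 * 2 ^ b := by gcongr
        _ = ((16 ^ b : ℕ) : ℝ) := by
          push_cast
          rw [show (16 : ℝ) = 2 ^ 4 by norm_num, ← pow_mul, ← pow_mul, ← pow_add]
          congr 1
          ring
    have h7 : (1 / 2 ^ b : ℝ) = 1 / 2 ^ (b + 1) + 1 / 2 ^ (b + 1) := by
      rw [pow_succ]
      field_simp
      norm_num
    change _ ≤ exp (-H A i) - _
    linarith
  obtain ⟨z, hz⟩ := exists_mul_card_le_card_filter _ _ hfrac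
  refine ⟨univ.image z.1 ∪ univ.image z.2, ⟨?_, ?_⟩, _, ?_, ?_, le_trans ?_ hz⟩
  · exact ⟨z.1 ⟨0, by positivity⟩, mem_union_left _ (mem_image_of_mem _ (mem_univ _))⟩
  · refine (card_union_le _ _).trans ((add_le_add card_image_le card_image_le).trans ?_)
    have : 4 ^ i ≤ 4 ^ (L - 1) := Nat.pow_le_pow_right (by norm_num) hiL
    simp only [card_univ, Fintype.card_fin]
    omega
  · exact (filter_subset _ _).trans (filter_subset _ _)
  · intro A hA
    exact (mem_filter.1 hA).2
  -- Fixing the most popular scale loses a factor `L ≤ 2 ^ b`.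
  · have hL2 : (L : ℝ) ≤ 2 ^ b := by
      have : L ≤ 2 ^ b := le_trans (by omega) Nat.lt_two_pow_self
      exact_mod_cast this
    have h8 : (s.card : ℝ) / 2 ^ b ≤ s.card / L := by gcongr
    calc (1 / 2 ^ (2 * b + 1) : ℝ) * s.card = 1 / 2 ^ (b + 1) * (s.card / 2 ^ b) := by
          rw [show 2 * b + 1 = (b + 1) + b by ring, pow_add]
          field_simp
      _ ≤ _ := by
          gcongr
          exact h8.trans hcard

/-- A family of small sets such that every short sequence of sets fails to isolate some member
of the family. -/
theorem exists_family_not_isolated {b L T₀ Δ R : ℕ} (hb : 1 ≤ b) (hL : 1 ≤ L)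
    (hLb : 2 * (L - 1) ≤ b) (hΔ : 2 * 4 ^ (L - 1) ≤ Δ) (hT : 24 * T₀ ≤ L * b)
    (hR : 2 ^ (15 * b) ≤ R) :
    ∃ F : ℕ → Finset (Fin (16 ^ b)), (∀ j, (F j).Nonempty ∧ (F j).card ≤ Δ) ∧
      ∀ A : Fin T₀ → Finset (Fin (16 ^ b)), ∃ j < R, ∀ r, (A r ∩ F j).card ≠ 1 := by
  classical
  have hp1 : (1 / 2 ^ (2 * b + 1) : ℝ) ≤ 1 :=
    div_le_one_of_le₀ (one_le_pow₀ (by norm_num)) (by positivity)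
  obtain ⟨F, hF, u, -, hu, hcard⟩ := exists_greedy_cover
    (fun (A : Fin T₀ → Finset (Fin (16 ^ b))) S => ∀ r, (A r ∩ S).card ≠ 1)
    (fun S => S.Nonempty ∧ S.card ≤ Δ) hp1
    (fun s => exists_set_not_isolated hb hL hLb hΔ hT s) univ R
  refine ⟨F, hF, fun A => hu A (mem_univ _) ?_⟩
  suffices h : (u.card : ℝ) < 1 by
    have : u.card = 0 := by
      have : u.card < 1 := by exact_mod_cast h
      omega
    simp [card_eq_zero.1 this]
  refine hcard.trans_lt ?_
  -- There are at most `exp (2 ^ (6 * b))` schedules, while `R` greedy steps shrink the remainder by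
  -- `exp (-2 ^ (12 * b))`, so fewer than one survives.
  have hcount : ((univ : Finset (Fin T₀ → Finset (Fin (16 ^ b)))).card : ℝ) ≤
      exp (2 ^ (6 * b)) := by
    rw [card_univ, Fintype.card_fun, Fintype.card_finset, Fintype.card_fin, Fintype.card_fin]
    push_cast
    have h1 : (2 : ℝ) ≤ exp 1 := by
      have := add_one_le_exp (1 : ℝ)
      linarith
    rw [← pow_mul]
    refine (pow_le_pow_left₀ (by norm_num) h1 _).trans ?_
    rw [← exp_nat_mul, mul_one]
    refine exp_le_exp.2 ?_
    have h2 : T₀ ≤ 2 ^ b * 2 ^ b :=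
      le_trans (by omega) (Nat.mul_le_mul ((show L ≤ b + 1 by omega).trans Nat.lt_two_pow_self)
        (Nat.lt_two_pow_self (n := b)).le)
    have h3 : 16 ^ b * T₀ ≤ 2 ^ (6 * b) := by
      refine (Nat.mul_le_mul_left _ h2).trans_eq ?_
      rw [show 16 = 2 ^ 4 by rfl, ← pow_mul, ← pow_add, ← pow_add]
      congr 1
      ring
    exact_mod_cast h3
  have hpow : (1 - 1 / 2 ^ (2 * b + 1) : ℝ) ^ R ≤ exp (-(2 ^ (12 * b))) := by
    have h1 : (1 - 1 / 2 ^ (2 * b + 1) : ℝ) ≤ exp (-(1 / 2 ^ (2 * b + 1))) := by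
      have := add_one_le_exp (-(1 / 2 ^ (2 * b + 1)) : ℝ)
      linarith
    refine (pow_le_pow_left₀ (by linarith) h1 R).trans ?_
    rw [← exp_nat_mul]
    refine exp_le_exp.2 ?_
    rw [mul_neg, mul_one_div]
    refine neg_le_neg ?_
    rw [le_div_iff₀ (by positivity), ← pow_add]
    refine le_trans (pow_le_pow_right₀ (by norm_num) ?_)
      (show (2 : ℝ) ^ (15 * b) ≤ R by exact_mod_cast hR)
    omega
  calc _ ≤ exp (-(2 ^ (12 * b))) * exp (2 ^ (6 * b)) :=
        mul_le_mul hpow hcount (by positivity) (exp_pos _).le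
    _ < 1 := by
        rw [← exp_add, exp_lt_one_iff]
        have : (2 : ℝ) ^ (6 * b) < 2 ^ (12 * b) := pow_lt_pow_right₀ (by norm_num) (by omega)
        linarith

/-! ### From set families to networks -/

namespace OneShotNetwork

variable {V : Type} [Fintype V] [DecidableEq V]

/-- The network with the given senders in which the neighbourhood of each receiver is prescribed. -/
def ofNeighborhoods (D : Finset V) (F : V → Finset V) (hFD : ∀ v, F v ⊆ D)
    (hF : ∀ v, (F v).Nonempty) : OneShotNetwork V where
  graph :=
    { Adj := fun u v => (u ∈ D ∧ v ∉ D ∧ u ∈ F v) ∨ (v ∈ D ∧ u ∉ D ∧ v ∈ F u)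
      symm := ⟨fun _ _ h => h.symm⟩
      loopless := ⟨fun _ h => h.elim (fun h => h.2.1 h.1) (fun h => h.2.1 h.1)⟩ }
  senders := D
  bipartite :=
    { disjoint := by
        rw [Finset.disjoint_coe]
        exact disjoint_compl_right
      mem_of_adj := by
        intro u v h
        simp only [Finset.mem_coe, Finset.mem_compl]
        rcases h with h | h
        exacts [Or.inl ⟨h.1, h.2.1⟩, Or.inr ⟨h.2.1, h.1⟩] }
  exists_sender := by
    intro v hv
    obtain ⟨u, hu⟩ := hF v
    exact ⟨u, hFD v hu, Or.inr ⟨hFD v hu, Finset.mem_compl.1 hv, hu⟩⟩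

variable {D : Finset V} {F : V → Finset V} {hFD : ∀ v, F v ⊆ D} {hF : ∀ v, (F v).Nonempty}

theorem mem_neighborsIn {N : OneShotNetwork V} {A : Finset V} {u v : V} :
    u ∈ N.neighborsIn A v ↔ u ∈ A ∧ N.graph.Adj v u := by
  simp [neighborsIn]

theorem adj_ofNeighborhoods {u v : V} : (ofNeighborhoods D F hFD hF).graph.Adj u v ↔
    (u ∈ D ∧ v ∉ D ∧ u ∈ F v) ∨ (v ∈ D ∧ u ∉ D ∧ v ∈ F u) :=
  Iff.rfl

theorem neighborsIn_ofNeighborhoods {B : Finset V} (hB : B ⊆ D) {v : V} (hv : v ∉ D) :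
    (ofNeighborhoods D F hFD hF).neighborsIn B v = B ∩ F v := by
  ext u
  rw [mem_neighborsIn, adj_ofNeighborhoods, Finset.mem_inter]
  constructor
  · rintro ⟨h1, h2 | h2⟩
    exacts [absurd h2.1 hv, ⟨h1, h2.2.2⟩]
  · rintro ⟨h1, h2⟩
    exact ⟨h1, Or.inr ⟨hB h1, hv, h2⟩⟩

theorem maxContention_ofNeighborhoods_le {Δ : ℕ} (h : ∀ v, (F v).card ≤ Δ) :
    (ofNeighborhoods D F hFD hF).maxContention ≤ Δ := by
  refine Finset.sup_le fun v _ => ?_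
  by_cases hv : v ∈ D
  · have : (ofNeighborhoods D F hFD hF).neighborsIn D v = ∅ := by
      ext u
      rw [mem_neighborsIn, adj_ofNeighborhoods, iff_false_right (Finset.notMem_empty u)]
      rintro ⟨h1, h2 | h2⟩
      exacts [h2.2.1 h1, h2.2.1 hv]
    change ((ofNeighborhoods D F hFD hF).neighborsIn D v).card ≤ Δ
    simp [this]
  · change ((ofNeighborhoods D F hFD hF).neighborsIn D v).card ≤ Δ
    rw [neighborsIn_ofNeighborhoods subset_rfl hv]
    exact (Finset.card_le_card Finset.inter_subset_right).trans (h v)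

theorem Schedule.Progressive.exists_card_inter_eq_one
    {T : ℕ} {σ : (ofNeighborhoods D F hFD hF).Schedule T} (h : σ.Progressive) {v : V}
    (hv : v ∉ D) : ∃ r, ((σ r).1 ∩ F v).card = 1 := by
  obtain ⟨r, -, hr⟩ := h v (Finset.mem_compl.2 hv)
  have hB : (σ r).1 ⊆ D := (σ r).2
  exact ⟨r, neighborsIn_ofNeighborhoods (hFD := hFD) (hF := hF) hB hv ▸ hr⟩

end OneShotNetwork

open OneShotNetwork

/-- Serves bounded `n`, where both logarithms are bounded. -/
theorem exists_network_one_le_length {n : ℕ} (hn : 2 ≤ n) :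
    ∃ N : OneShotNetwork (Fin n), N.maxContention ≤ 1 ∧
      ∀ (T : ℕ) (σ : N.Schedule T), σ.Progressive → 1 ≤ T := by
  refine ⟨ofNeighborhoods {⟨0, by omega⟩} (fun _ => {⟨0, by omega⟩}) (fun _ => subset_rfl)
    (fun _ => Finset.singleton_nonempty _), maxContention_ofNeighborhoods_le fun _ => by simp, ?_⟩
  intro T σ hσ
  obtain ⟨r, -⟩ := hσ.exists_card_inter_eq_one (v := ⟨1, by omega⟩) (by simp)
  exact Nat.one_le_of_lt r.2

theorem exists_network_mul_le_length {n b L Δ : ℕ} (hb : 1 ≤ b) (hL : 1 ≤ L)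
    (hLb : 2 * (L - 1) ≤ b) (hΔ : 2 * 4 ^ (L - 1) ≤ Δ) (hn : 2 ^ (16 * b) ≤ n) :
    ∃ N : OneShotNetwork (Fin n), N.maxContention ≤ Δ ∧
      ∀ (T : ℕ) (σ : N.Schedule T), σ.Progressive → L * b < 24 * T := by
  have hm : 16 ^ b = 2 ^ (4 * b) := by rw [pow_mul]; norm_num
  have hR : 16 ^ b + 2 ^ (15 * b) ≤ n := by
    refine le_trans ?_ hn
    have h1 : 2 ^ (4 * b) ≤ 2 ^ (15 * b) := Nat.pow_le_pow_right (by norm_num) (by omega)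
    have h2 : 2 ^ (15 * b + 1) ≤ 2 ^ (16 * b) := Nat.pow_le_pow_right (by norm_num) (by omega)
    rw [pow_succ] at h2
    omega
  obtain ⟨F, hF, hiso⟩ := exists_family_not_isolated (T₀ := L * b / 24) hb hL hLb hΔ
    (Nat.mul_div_le _ _) le_rfl
  let e : Fin (16 ^ b) ↪ Fin n := Fin.castLEEmb ((Nat.le_add_right _ _).trans hR)
  -- Node `16 ^ b + j` is the receiver with neighbourhood `F j`; the value that truncated
  -- subtraction gives at senders plays no role.
  refine ⟨ofNeighborhoods (Finset.univ.map e) (fun v => (F (v - 16 ^ b)).map e)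
    (fun v => Finset.map_subset_map.2 (Finset.subset_univ _)) (fun v => (hF _).1.map),
    maxContention_ofNeighborhoods_le fun v => by simpa using (hF _).2, fun T σ hσ => ?_⟩
  by_contra! hT
  have hT' : T ≤ L * b / 24 := by omega
  -- Shorter schedules are padded with silent rounds.
  obtain ⟨j, hj, hjr⟩ := hiso fun r =>
    if h : (r : ℕ) < T then Finset.univ.filter fun x => e x ∈ (σ ⟨r, h⟩).1 else ∅
  obtain ⟨r, hr⟩ := hσ.exists_card_inter_eq_one (v := ⟨16 ^ b + j, by omega⟩) (by
    simp only [Finset.mem_map, Finset.mem_univ, true_and, not_exists]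
    intro x hx
    have h1 : (x : ℕ) = 16 ^ b + j := congrArg Fin.val hx
    have := x.2
    omega)
  refine hjr ⟨r, by omega⟩ ?_
  rw [← hr]
  simp only [Fin.is_lt, dif_pos, Nat.add_sub_cancel_left, Fin.eta]
  rw [← Finset.card_map e]
  congr 1
  ext x
  simp only [Finset.mem_map, Finset.mem_inter, Finset.mem_filter, Finset.mem_univ, true_and]
  constructor
  · rintro ⟨y, ⟨h1, h2⟩, rfl⟩
    exact ⟨h1, y, h2, rfl⟩
  · rintro ⟨h1, y, h2, rfl⟩
    exact ⟨y, ⟨h1, h2⟩, rfl⟩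

/-! ### Choice of parameters -/

theorem log_le_mul_log_two_of_lt_two_pow {x k : ℕ} (hx : 1 ≤ x) (h : x < 2 ^ k) :
    log (x : ℝ) ≤ k * log 2 := by
  rw [← log_pow]
  refine log_le_log (by exact_mod_cast hx) ?_
  exact_mod_cast h.le

theorem log_le_of_lt_two_pow {x k : ℕ} (hx : 1 ≤ x) (h : x < 2 ^ k) : log (x : ℝ) ≤ k := by
  have h1 := log_le_mul_log_two_of_lt_two_pow hx h
  have h2 := log_two_lt_d9
  have h3 : (0 : ℝ) ≤ k := by positivity
  nlinarith

/-- The number of usable scales is at least proportional to the logarithm of the contention. -/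
theorem exists_number_of_scales {n b Δ : ℕ} (hΔ : 2 ≤ Δ) (hΔn : Δ ≤ n) (hb : 1 ≤ b)
    (hn : n < 2 ^ (16 * b + 16)) :
    ∃ L, 1 ≤ L ∧ 2 * (L - 1) ≤ b ∧ 2 * 4 ^ (L - 1) ≤ Δ ∧ log (Δ : ℝ) ≤ 64 * L := by
  -- `L - 1` is the smaller of the limits set by `Δ` and by `b`; in the second case `log Δ ≤ log n`
  -- suffices.
  rcases le_total (Nat.log 4 (Δ / 2)) (b / 2) with h | h
  · refine ⟨Nat.log 4 (Δ / 2) + 1, by omega, by omega, ?_, ?_⟩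
    · have := Nat.pow_log_le_self 4 (x := Δ / 2) (by omega)
      simp only [Nat.add_sub_cancel]
      omega
    · have h1 := Nat.lt_pow_succ_log_self (b := 4) (by norm_num) (Δ / 2)
      set l := Nat.log 4 (Δ / 2)
      have h2 : Δ < 2 ^ (2 * l + 3) := by
        have h3 : 2 ^ (2 * l + 3) = 2 * 4 ^ (l + 1) := by
          rw [show 2 * l + 3 = 2 * (l + 1) + 1 by ring, pow_succ, pow_mul]
          norm_num [mul_comm]
        rw [h3]
        simp only [Nat.succ_eq_add_one] at h1
        omega
      have h4 := log_le_of_lt_two_pow (by omega) h2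
      push_cast at h4 ⊢
      have : (0 : ℝ) ≤ l := by positivity
      linarith
  · refine ⟨b / 2 + 1, by omega, by omega, ?_, ?_⟩
    · have h1 := Nat.pow_log_le_self 4 (x := Δ / 2) (by omega)
      have h2 : 4 ^ (b / 2) ≤ 4 ^ Nat.log 4 (Δ / 2) := Nat.pow_le_pow_right (by norm_num) h
      simp only [Nat.add_sub_cancel]
      omega
    · refine (log_le_of_lt_two_pow (by omega) (hΔn.trans_lt hn)).trans ?_
      have h1 : 16 * b + 16 ≤ 64 * (b / 2 + 1) := by omega
      exact_mod_cast h1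

theorem mainTheorem5 :
    ∃ c : ℝ, 0 < c ∧ ∀ n Δ : ℕ, 1 ≤ Δ → Δ ≤ n →
      ∃ N : OneShotNetwork (Fin n), N.maxContention ≤ Δ ∧
        ∀ (T : ℕ) (σ : N.Schedule T), σ.Progressive →
          c * Real.log (Δ : ℝ) * Real.log (n : ℝ) ≤ (T : ℝ) := by
  -- The factors come from `L * b < 24 * T`, `log Δ ≤ 64 * L` and `log n ≤ 32 * b`.
  refine ⟨1 / (24 * 64 * 32), by norm_num, fun n Δ hΔ hΔn => ?_⟩
  have hlogn : 0 ≤ log (n : ℝ) := log_natCast_nonneg n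
  have hlogΔ : 0 ≤ log (Δ : ℝ) := log_natCast_nonneg Δ
  rcases hΔ.eq_or_lt with rfl | hΔ2
  · refine ⟨ofNeighborhoods {⟨0, by omega⟩} (fun _ => {⟨0, by omega⟩}) (fun _ => subset_rfl)
      (fun _ => Finset.singleton_nonempty _), maxContention_ofNeighborhoods_le fun _ => by simp, ?_⟩
    intro T _ _
    simp
  obtain ⟨b, hb1, hb2⟩ : ∃ b, 2 ^ (16 * b) ≤ n ∧ n < 2 ^ (16 * b + 16) := by
    refine ⟨Nat.log (2 ^ 16) n, ?_, ?_⟩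
    · rw [pow_mul]
      exact Nat.pow_log_le_self _ (by omega)
    · have := Nat.lt_pow_succ_log_self (b := 2 ^ 16) (by norm_num) n
      rwa [← pow_mul, Nat.succ_eq_add_one, mul_add, mul_one] at this
  have hn := log_le_of_lt_two_pow (by omega) hb2
  rcases Nat.eq_zero_or_pos b with rfl | hb
  · obtain ⟨N, hN, h⟩ := exists_network_one_le_length (n := n) (by omega)
    refine ⟨N, hN.trans hΔ, fun T σ hσ => ?_⟩
    have hT : (1 : ℝ) ≤ T := by exact_mod_cast h T σ hσ
    have hΔlog := log_le_of_lt_two_pow (by omega) (hΔn.trans_lt hb2)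
    have := mul_le_mul hΔlog hn hlogn (by positivity)
    norm_num at this ⊢
    linarith
  · obtain ⟨L, hL, hLb, hLΔ, hlog⟩ := exists_number_of_scales hΔ2 hΔn hb hb2
    obtain ⟨N, hN, h⟩ := exists_network_mul_le_length hb hL hLb hLΔ hb1
    refine ⟨N, hN, fun T σ hσ => ?_⟩
    have hT : (L * b : ℝ) ≤ 24 * T := by exact_mod_cast (h T σ hσ).le
    have hn' : log (n : ℝ) ≤ 32 * b := by
      refine hn.trans ?_
      have : 16 * b + 16 ≤ 32 * b := by omega
      exact_mod_cast this
    have := mul_le_mul hlog hn' hlogn (by positivity)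
    linarith
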